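/- Let $\mathbb{R}^n$ carry an inner product $\langle\cdot,\cdot\rangle$ with induced norm $\|\cdot\|$. For $\Phi:\mathbb{R}^n\to\overline{\mathbb{R}}$ put $\operatorname{dom}\Phi=\{x:\Phi(x)<\infty\}$ and let $\partial\Phi$ denote the Clarke subdifferential, i.e. $v\in\partial\Phi(x)$ iff $\Phi(x)$ is finite and $(v,-1)$ belongs to the closed convex hull of the limiting normal cone of $\operatorname{epi}\Phi$ at $(x,\Phi(x))$ (for proper convex $\Phi$ this is the convex subdifferential). A set-valued mapping $D:\mathbb{R}^n\rightrightarrows\mathbb{R}^n$ is a conservative field for a function $\Phi:\mathbb{R}^n\to\overline{\mathbb{R}}$ that is locally Lipschitz on its domain if it has closed graph, $\operatorname{dom}D:=\{x:D(x)\neq\emptyset\}\subset\operatorname{dom}\Phi$, and for every absolutely continuous $x:[0,1]\to\operatorname{dom}D$ one has, for almost every $t\in(0,1)$, $(\Phi\circ x)'(t)=\langle v,x'(t)\rangle$ for all $v\in D(x(t))$. It is locally bounded if every point has a neighbourhood $U$ such that $D(U)$ is bounded. Let $f_1,\dots,f_N:\mathbb{R}^n\to\mathbb{R}$ be locally Lipschitz;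 for each $i$ let $D_i:\mathbb{R}^n\rightrightarrows\mathbb{R}^n$ be a locally bounded conservative field for $f_i$ with nonempty convex values; let $g:\mathbb{R}^n\to\overline{\mathbb{R}}$ be proper, convex, with closed domain and locally Lipschitz on its domain; and let $\Phi:=f_1+\cdots+f_N+g$ be bounded below. Put $D_\Phi:=D_1+\cdots+D_N+\partial g$. Let $I\subset\mathbb{R}_+=[0,\infty)$ be a nondegenerate interval containing $0$. A solution of $x'\in-D_\Phi(x)$ on $I$ is a function $x:I\to\mathbb{R}^n$ that is absolutely continuous (on every compact subinterval of $I$) and satisfies $x'(t)\in-D_\Phi(x(t))$ for almost every $t\in I$. A $D_\Phi$-trajectory is a solution that is maximal, i.e. not the restriction of a solution defined on a strictly larger such interval. Then every $D_\Phi$-trajectory is defined on all of $\mathbb{R}_+$. Moreover, for every $x_0\in\operatorname{dom}\Phi$ there exists a $D_\Phi$-trajectory $x:\mathbb{R}_+\to\mathbb{R}^n$ with $x(0)=x_0$. -/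

import Mathlib

open Set Filter Topology MeasureTheory
open scoped Pointwise RealInnerProductSpace

noncomputable section

namespace ProxRR

/-! ### Extended-real-valued functions -/

section Functions

variable {E : Type*}

/-- The (effective) domain `{x | Φ x < ∞}` of an extended-real-valued function. -/
def effDom (Φ : E → EReal) : Set E := {x | Φ x < ⊤}

/-- The epigraph `{(x, t) | Φ x ≤ t}`, a subset of `E × ℝ`. -/
def epi (Φ : E → EReal) : Set (E × ℝ) := {p | Φ p.1 ≤ (p.2 : EReal)}

/-- `Φ` is proper: never `-∞`, and not identically `+∞`. -/
def IsProper (Φ : E → EReal) : Prop := (∀ x, Φ x ≠ ⊥) ∧ (effDom Φ).Nonempty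

/-- `Φ` is locally Lipschitz continuous on its domain (so it is finite there). -/
def LocLipschitzOnDom [PseudoEMetricSpace E] (Φ : E → EReal) : Prop :=
  (∀ x ∈ effDom Φ, Φ x ≠ ⊥) ∧ LocallyLipschitzOn (effDom Φ) (fun x => (Φ x).toReal)

end Functions

/-! ### The Clarke subdifferential, through normal cones to the epigraph -/

section Normals

variable {F : Type*} [NormedAddCommGroup F] [NormedSpace ℝ F]

/-- Regular (Fréchet) normals to `C` at `z ∈ C`: functionals `φ` with
`φ (w - z) ≤ o(‖w - z‖)` as `w → z` in `C`. -/
def regularNormals (C : Set F) (z : F) : Set (F →L[ℝ] ℝ) :=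
  {φ | z ∈ C ∧ ∀ ε : ℝ, 0 < ε → ∀ᶠ w in 𝓝[C] z, φ (w - z) ≤ ε * ‖w - z‖}

/-- Limiting normals to `C` at `z ∈ C`: limits of regular normals at points of `C` tending
to `z`. -/
def limitingNormals (C : Set F) (z : F) : Set (F →L[ℝ] ℝ) :=
  {φ | z ∈ C ∧ ∃ (w : ℕ → F) (ψ : ℕ → F →L[ℝ] ℝ),
    Tendsto w atTop (𝓝 z) ∧ Tendsto ψ atTop (𝓝 φ) ∧ ∀ k, ψ k ∈ regularNormals C (w k)}

/-- Clarke (convexified) normals: the closed convex hull of the limiting normals. -/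
def clarkeNormals (C : Set F) (z : F) : Set (F →L[ℝ] ℝ) :=
  closure (convexHull ℝ (limitingNormals C z))

end Normals

variable {E : Type*} [NormedAddCommGroup E] [InnerProductSpace ℝ E]

/-- The Clarke subdifferential of an extended-real-valued function: `v ∈ ∂Φ(x)` iff `Φ x` is
finite and `(v, -1)`, that is the functional `(y, t) ↦ ⟪v, y⟫ - t`, is a Clarke normal to the
epigraph of `Φ` at `(x, Φ x)`. -/
def clarkeSubdiff (Φ : E → EReal) (x : E) : Set E :=
  {v | Φ x ≠ ⊥ ∧ Φ x ≠ ⊤ ∧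
    (innerSL ℝ v).comp (ContinuousLinearMap.fst ℝ E ℝ) - ContinuousLinearMap.snd ℝ E ℝ
      ∈ clarkeNormals (epi Φ) (x, (Φ x).toReal)}

/-! ### Set-valued mappings `E ⇉ E` and conservative fields -/

/-- The graph of a set-valued mapping. -/
def graph (D : E → Set E) : Set (E × E) := {p | p.2 ∈ D p.1}

/-- Every point has a neighbourhood `U` with `D(U)` bounded. -/
def IsLocBounded (D : E → Set E) : Prop :=
  ∀ x, ∃ U ∈ 𝓝 x, Bornology.IsBounded (⋃ y ∈ U, D y)

/-- `D` is a conservative field for the function `Φ` (which is meant to be locally Lipschitz on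
its domain): `D` has closed graph, `dom D ⊆ dom Φ`, and along every absolutely continuous
`x : [0,1] → dom D` the chain rule `(Φ ∘ x)'(t) = ⟪v, x'(t)⟫` holds for almost every
`t ∈ (0,1)` and all `v ∈ D (x t)`. -/
structure IsConservativeField (Φ : E → EReal) (D : E → Set E) : Prop where
  closed_graph : IsClosed (graph D)
  dom_subset : ∀ x, (D x).Nonempty → x ∈ effDom Φ
  chain_rule : ∀ x : ℝ → E, AbsolutelyContinuousOnInterval x 0 1 →
    (∀ t ∈ Icc (0 : ℝ) 1, (D (x t)).Nonempty) →
    ∀ᵐ t ∂(volume.restrict (Ioo (0 : ℝ) 1)), ∃ x' : E, HasDerivAt x x' t ∧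
      ∀ v ∈ D (x t), HasDerivAt (fun s => (Φ (x s)).toReal) ⟪v, x'⟫ t

/-! ### Solutions of the differential inclusion `x' ∈ -D(x)` and trajectories -/

/-- `I` is a nondegenerate interval of `ℝ₊ = [0,∞)` that contains the initial time `0`. -/
def IsTimeInterval (I : Set ℝ) : Prop :=
  I.OrdConnected ∧ I ⊆ Ici 0 ∧ (0 : ℝ) ∈ I ∧ I.Nontrivial

/-- `x : I → E` is a solution of `x' ∈ -D(x)`: `x` is absolutely continuous (on every compact
subinterval of `I`) and `x'(t) ∈ -D(x(t))` for almost every `t ∈ I`.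
Only the values of `x` on `I` matter. -/
def IsSolution (D : E → Set E) (I : Set ℝ) (x : ℝ → E) : Prop :=
  IsTimeInterval I ∧
  (∀ a ∈ I, ∀ b ∈ I, AbsolutelyContinuousOnInterval x a b) ∧
  ∀ᵐ t ∂(volume.restrict I), ∃ x' ∈ -D (x t), HasDerivWithinAt x x' I t

/-- `x : I → E` is a `D`-trajectory: a solution of `x' ∈ -D(x)` which is maximal, that is, which
is not the restriction of a solution defined on a strictly larger interval. -/
def IsTrajectory (D : E → Set E) (I : Set ℝ) (x : ℝ → E) : Prop :=
  IsSolution D I x ∧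
  ∀ (J : Set ℝ) (y : ℝ → E), IsSolution D J y → I ⊆ J → EqOn x y I → J = I

/-! ### The composite model -/

/-- The objective `Φ = f₁ + ⋯ + f_N + g`. -/
def objective {N : ℕ} (f : Fin N → E → ℝ) (g : E → EReal) (x : E) : EReal :=
  ((∑ i, f i x : ℝ) : EReal) + g x

/-- The set-valued mapping `D_Φ = D₁ + ⋯ + D_N + ∂g` (Minkowski sums of the values). -/
def fieldSum {N : ℕ} (D : Fin N → E → Set E) (g : E → EReal) (x : E) : Set E :=
  (∑ i, D i x) + clarkeSubdiff g x

/-- The standing assumptions on `f₁, …, f_N`, the conservative fields `D₁, …, D_N` and `g`. -/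
structure StandingAssumption {N : ℕ} (f : Fin N → E → ℝ) (D : Fin N → E → Set E)
    (g : E → EReal) : Prop where
  f_locLipschitz : ∀ i, LocallyLipschitz (f i)
  D_conservative : ∀ i, IsConservativeField (fun x => (f i x : EReal)) (D i)
  D_locBounded : ∀ i, IsLocBounded (D i)
  D_nonempty : ∀ i x, (D i x).Nonempty
  D_convex : ∀ i x, Convex ℝ (D i x)
  g_proper : IsProper g
  g_convex : Convex ℝ (epi g)
  g_closed_dom : IsClosed (effDom g)
  g_locLipschitz : LocLipschitzOnDom g
  bddBelow : ∃ m : ℝ, ∀ x, (m : EReal) ≤ objective f g x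

end ProxRR

end

/-! The objective is a Lyapunov function. If `x' = -(v + w)` with `v` in the sum of the conservative
fields and `w` a subgradient of `g`, the chain rules give `(Φ ∘ x)' = ⟪v + w, x'⟫ = -‖x'‖²` almost
everywhere. Since `Φ ≥ m`, the integral of `‖x'‖²` over `[0, b]` is at most `Φ (x 0) - m`, and `r ≤
(r² + 1) / 2` bounds the length by `(Φ (x 0) - m + b) / 2` (`StandingAssumption.energy_estimate`).
Thus a solution on a bounded interval has an integrable velocity up to the end time, and its limit
there lies in the closed set `dom g`. Restarting from that limit extends it, so a maximal solution
lives on all of `[0, ∞)`.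

Existence is proved on unit time intervals, whose solutions are then glued
(`exists_isVelocity_of_unit`). Truncate `dom g` to a compact convex set `K` by a closed ball of
radius `R` about the starting point. Proximal gradient steps for `g` restricted to `K` have
uniformly bounded slopes (`exists_proximal_step`). Closed graphs and convex values make the limit of
these polygons a solution for the truncated problem (`exists_lipschitz_solution_of_steps`). The
energy estimate holds for truncated subgradients too, and `R` exceeds the resulting bound on the
length: the curve never reaches the sphere, so its truncated subgradients are true subgradients
(`restrictedSubgradients_of_ball`). -/

namespace AbsolutelyContinuousOnInterval

/-! ### Absolutely continuous curves. -/

variable {X Y : Type*} [PseudoMetricSpace X] [PseudoMetricSpace Y]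

/-- Absolute continuity passes to functions whose increments are controlled. -/
theorem of_dist_le_mul {φ : ℝ → X} {ψ : ℝ → Y} {a b : ℝ} (hφ : AbsolutelyContinuousOnInterval φ a b)
    (C : ℝ) (h : ∀ s ∈ uIcc a b, ∀ t ∈ uIcc a b, dist (ψ s) (ψ t) ≤ C * dist (φ s) (φ t)) :
    AbsolutelyContinuousOnInterval ψ a b := by
  unfold AbsolutelyContinuousOnInterval at hφ ⊢
  refine squeeze_zero' (Eventually.of_forall fun t => Finset.sum_nonneg fun i _ => dist_nonneg) ?_
    (by simpa using hφ.const_mul C)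
  have : ∀ᶠ I in totalLengthFilter ⊓ 𝓟 (disjWithin a b), I ∈ disjWithin a b :=
    mem_inf_of_right (mem_principal_self _)
  filter_upwards [this] with I hI
  rw [Finset.mul_sum]
  exact Finset.sum_le_sum fun i hi => h _ (hI.1 i hi).1 _ (hI.1 i hi).2

theorem lipschitzOnWith_comp {φ : ℝ → X} {ψ : X → Y} {a b : ℝ} {K : NNReal} {s : Set X}
    (hφ : AbsolutelyContinuousOnInterval φ a b) (hψ : LipschitzOnWith K ψ s)
    (hs : ∀ t ∈ uIcc a b, φ t ∈ s) : AbsolutelyContinuousOnInterval (fun t => ψ (φ t)) a b :=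
  hφ.of_dist_le_mul K fun r hr t ht => hψ.dist_le_mul _ (hs r hr) _ (hs t ht)

/-- The composition of an absolutely continuous function with a locally Lipschitz one. -/
theorem locallyLipschitzOn_comp {F : Type*} [NormedAddCommGroup F] {φ : ℝ → F} {ψ : F → Y}
    {a b : ℝ} {s : Set F}
    (hφ : AbsolutelyContinuousOnInterval φ a b) (hψ : LocallyLipschitzOn s ψ)
    (hs : ∀ t ∈ uIcc a b, φ t ∈ s) : AbsolutelyContinuousOnInterval (fun t => ψ (φ t)) a b := by
  have hK : IsCompact (φ '' uIcc a b) := isCompact_uIcc.image_of_continuousOn hφ.continuousOn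
  have hsub : φ '' uIcc a b ⊆ s := by
    rintro _ ⟨t, ht, rfl⟩
    exact hs t ht
  obtain ⟨K, hK⟩ := (hψ.mono hsub).exists_lipschitzOnWith_of_compact hK
  exact hφ.lipschitzOnWith_comp hK fun t ht => mem_image_of_mem _ ht

/-- Rescaling of the time variable. -/
theorem comp_const_mul {φ : ℝ → X} {b : ℝ} (hb : 0 < b)
    (hφ : AbsolutelyContinuousOnInterval φ 0 b) :
    AbsolutelyContinuousOnInterval (fun t => φ (b * t)) 0 1 := by
  rw [absolutelyContinuousOnInterval_iff] at hφ ⊢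
  intro ε hε
  obtain ⟨δ, hδ, H⟩ := hφ ε hε
  refine ⟨δ / b, by positivity, fun I hI hlen => ?_⟩
  refine H (I.1, fun i => (b * (I.2 i).1, b * (I.2 i).2)) ⟨fun i hi => ?_, ?_⟩ ?_
  · obtain ⟨h1, h2⟩ := hI.1 i hi
    rw [uIcc_of_le zero_le_one] at h1 h2
    rw [uIcc_of_le hb.le]
    exact ⟨⟨by nlinarith [h1.1], by nlinarith [h1.2]⟩, ⟨by nlinarith [h2.1], by nlinarith [h2.2]⟩⟩
  · intro i hi j hj hij
    have hd := hI.2 hi hj hij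
    simp only [Function.onFun] at hd ⊢
    rw [Set.disjoint_left] at hd ⊢
    have key : ∀ k t, t ∈ uIoc (b * (I.2 k).1) (b * (I.2 k).2) →
        t / b ∈ uIoc (I.2 k).1 (I.2 k).2 := by
      intro k t ht
      rw [mem_uIoc] at ht ⊢
      rw [lt_div_iff₀ hb, div_le_iff₀ hb, lt_div_iff₀ hb, div_le_iff₀ hb]
      simpa only [mul_comm b] using ht
    exact fun t h1 h2 => hd (key i t h1) (key j t h2)
  · have : ∀ i, dist (b * (I.2 i).1) (b * (I.2 i).2) = b * dist (I.2 i).1 (I.2 i).2 := fun i => by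
      rw [Real.dist_eq, Real.dist_eq, ← mul_sub, abs_mul, abs_of_pos hb]
    simp only [this, ← Finset.mul_sum]
    rwa [lt_div_iff₀ hb, mul_comm] at hlen

end AbsolutelyContinuousOnInterval

section VectorValued

variable {E : Type*} [NormedAddCommGroup E] [NormedSpace ℝ E]

/-- Indefinite integrals of vector-valued functions are absolutely continuous. -/
theorem absolutelyContinuousOnInterval_integral {u : ℝ → E} {a b : ℝ}
    (hu : IntervalIntegrable u volume a b) :
    AbsolutelyContinuousOnInterval (fun t => ∫ s in a..t, u s) a b := by
  -- Increments of `∫ u` are dominated by those of the real function `∫ ‖u‖`.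
  refine (hu.norm.absolutelyContinuousOnInterval_intervalIntegral
    (c := a) left_mem_uIcc).of_dist_le_mul 1 fun s hs t ht => ?_
  have hint : ∀ r ∈ uIcc a b, IntervalIntegrable u volume a r := fun r hr =>
    hu.mono_set (uIcc_subset_uIcc_left hr)
  rw [dist_eq_norm, Real.dist_eq, one_mul,
    intervalIntegral.integral_interval_sub_left (hint s hs) (hint t ht),
    intervalIntegral.integral_interval_sub_left (hint s hs).norm (hint t ht).norm]
  exact intervalIntegral.norm_integral_le_abs_integral_norm

/-- The fundamental theorem of calculus for vector-valued absolutely continuous functions. -/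
theorem AbsolutelyContinuousOnInterval.eq_add_integral [CompleteSpace E] {x u : ℝ → E} {b : ℝ}
    (hb : 0 < b) (hx : AbsolutelyContinuousOnInterval x 0 b) (hu : IntervalIntegrable u volume 0 b)
    (hd : ∀ᵐ t ∂(volume.restrict (Ioo (0 : ℝ) b)), HasDerivAt x (u t) t) {t : ℝ}
    (ht : t ∈ Icc 0 b) : x t = x 0 + ∫ s in (0 : ℝ)..t, u s := by
  have hIcc : uIcc 0 b = Icc 0 b := uIcc_of_le hb.le
  obtain ⟨C, hC⟩ := (hx.sub (absolutelyContinuousOnInterval_integral hu)).const_of_ae_hasDerivAt_zero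
    (by
      rw [ae_restrict_iff' measurableSet_Ioo] at hd
      have h0 : ∀ᵐ t : ℝ, t ≠ 0 := by simp [ae_iff, measure_singleton]
      have h1 : ∀ᵐ t : ℝ, t ≠ b := by simp [ae_iff, measure_singleton]
      filter_upwards [hd, hu.ae_hasDerivAt_integral, h0, h1] with t h1 h2 h3 h4 ht
      have ht' := ht
      rw [hIcc] at ht'
      have := (h1 ⟨lt_of_le_of_ne ht'.1 h3.symm, lt_of_le_of_ne ht'.2 h4⟩).sub
        (h2 ht 0 left_mem_uIcc)
      simpa using this)
  have h0 := hC 0 left_mem_uIcc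
  have ht := hC t (hIcc ▸ ht)
  simp only [Pi.sub_apply, intervalIntegral.integral_same, sub_zero] at h0 ht
  rw [h0, ← ht, sub_add_cancel]

end VectorValued

/-- A continuous curve on `[0,b]` which is in a closed set at almost all times stays in it. -/
theorem IsClosed.forall_mem_of_ae_mem {X : Type*} [PseudoMetricSpace X] {x : ℝ → X} {b : ℝ}
    {C : Set X} (hC : IsClosed C)
    (hb : 0 < b) (hx : ContinuousOn x (Icc 0 b))
    (h : ∀ᵐ t ∂(volume.restrict (Ioo (0 : ℝ) b)), x t ∈ C) : ∀ t ∈ Icc 0 b, x t ∈ C := by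
  have hae : ∀ᵐ t ∂(volume.restrict (Icc (0 : ℝ) b)), x t ∈ C := by
    rwa [Measure.restrict_congr_set Ioo_ae_eq_Icc] at h
  -- `Metric.infDist` to the empty set is `0` by default, so emptiness has to be excluded before the
  -- distance can detect membership.
  have hne : C.Nonempty := by
    by_contra hemp
    rw [not_nonempty_iff_eq_empty] at hemp
    simp only [hemp, mem_empty_iff_false, ae_iff, not_false_eq_true, ofPred_true,
      Measure.restrict_apply_univ, Real.volume_Icc, sub_zero, ENNReal.ofReal_eq_zero] at hae
    exact absurd hae (not_le.2 hb)
  have := Measure.eqOn_Icc_of_ae_eq (μ := volume) (f := fun t => Metric.infDist (x t) C)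
    (g := fun _ => (0 : ℝ)) hb.ne
    (by filter_upwards [hae] with t ht using Metric.infDist_zero_of_mem ht)
    ((Metric.continuous_infDist_pt C).comp_continuousOn hx) continuousOn_const
  exact fun t ht => (hC.mem_iff_infDist_zero hne).2 (this ht)

/-! ### Clarke normals and subgradients in the convex case. -/

namespace ProxRR

section Subgradients

variable {E : Type*} [NormedAddCommGroup E] [InnerProductSpace ℝ E]

/-- For a convex set all Clarke normals are normals in the sense of convex analysis. -/
theorem le_zero_of_mem_clarkeNormals {F : Type*} [NormedAddCommGroup F] [NormedSpace ℝ F]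
    {C : Set F} (hC : Convex ℝ C) {z w : F} (hw : w ∈ C) {φ : F →L[ℝ] ℝ}
    (hφ : φ ∈ clarkeNormals C z) : φ (w - z) ≤ 0 := by
  have hreg : ∀ y, ∀ ψ ∈ regularNormals C y, ψ (w - y) ≤ 0 := by
    rintro y ψ ⟨hy, hψ⟩
    by_contra! hpos
    have hne : 0 < ‖w - y‖ := by
      rw [norm_pos_iff]
      intro h0
      simp [h0] at hpos
    -- Test the regular normal along the segment from `y` to `w`. Taking `ε` to be half of its slope
    -- there contradicts a positive value.
    have hlim : Tendsto (fun t : ℝ => y + t • (w - y)) (𝓝[>] 0) (𝓝[C] y) := by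
      refine tendsto_nhdsWithin_iff.2 ⟨?_, ?_⟩
      · have : Tendsto (fun t : ℝ => y + t • (w - y)) (𝓝 0) (𝓝 (y + (0 : ℝ) • (w - y))) :=
          Continuous.tendsto (by fun_prop) 0
        rw [zero_smul, add_zero] at this
        exact this.mono_left nhdsWithin_le_nhds
      · filter_upwards [Ioo_mem_nhdsGT (zero_lt_one (α := ℝ))] with t ht
        exact hC.add_smul_sub_mem hy hw ⟨ht.1.le, ht.2.le⟩
    have hev := hlim.eventually (hψ (ψ (w - y) / (2 * ‖w - y‖)) (by positivity))
    obtain ⟨t, ht, ht0⟩ := (hev.and self_mem_nhdsWithin).exists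
    have ht0 : 0 < t := ht0
    rw [add_sub_cancel_left, map_smul, norm_smul, Real.norm_of_nonneg ht0.le, smul_eq_mul] at ht
    have : ψ (w - y) / (2 * ‖w - y‖) * (t * ‖w - y‖) = t * ψ (w - y) / 2 := by
      field_simp
    nlinarith [mul_pos ht0 hpos]
  have hclosed : IsClosed {ψ : F →L[ℝ] ℝ | ψ (w - z) ≤ 0} :=
    isClosed_le (by fun_prop) continuous_const
  have hconv : Convex ℝ {ψ : F →L[ℝ] ℝ | ψ (w - z) ≤ 0} := by
    intro ψ₁ h₁ ψ₂ h₂ a b ha hb _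
    have h₁ : ψ₁ (w - z) ≤ 0 := h₁
    have h₂ : ψ₂ (w - z) ≤ 0 := h₂
    change a * ψ₁ (w - z) + b * ψ₂ (w - z) ≤ 0
    nlinarith [mul_nonneg ha (neg_nonneg.2 h₁), mul_nonneg hb (neg_nonneg.2 h₂)]
  refine closure_minimal (convexHull_min ?_ hconv) hclosed hφ
  rintro ψ ⟨_, y, ψs, hy, hψs, hmem⟩
  refine le_of_tendsto (f := fun k => ψs k (w - y k)) (x := atTop) ?_
    (Eventually.of_forall fun k => hreg _ _ (hmem k))
  exact ((isBoundedBilinearMap_apply (𝕜 := ℝ) (E := F) (F := ℝ)).continuous.tendsto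
    (ψ, w - z)).comp (hψs.prodMk_nhds (tendsto_const_nhds.sub hy))

/-- The Clarke subdifferential of a convex function consists of convex subgradients. -/
theorem inner_le_of_mem_clarkeSubdiff {g : E → EReal} (hg : Convex ℝ (epi g)) {x y v : E}
    (hv : v ∈ clarkeSubdiff g x) (hy : g y ≠ ⊤) :
    (g x).toReal + ⟪v, y - x⟫ ≤ (g y).toReal := by
  have hmem : (y, (g y).toReal) ∈ epi g := EReal.le_coe_toReal hy
  have := le_zero_of_mem_clarkeNormals hg hmem hv.2.2
  simp only [Prod.mk_sub_mk, sub_apply, ContinuousLinearMap.comp_apply,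
    ContinuousLinearMap.coe_fst', ContinuousLinearMap.coe_snd', innerSL_apply_apply] at this
  linarith

/-- Convex subgradients belong to the Clarke subdifferential. -/
theorem mem_clarkeSubdiff {g : E → EReal} (hbot : ∀ y, g y ≠ ⊥) {x v : E} (hx : g x ≠ ⊤)
    (hv : ∀ y, g y ≠ ⊤ → (g x).toReal + ⟪v, y - x⟫ ≤ (g y).toReal) : v ∈ clarkeSubdiff g x := by
  refine ⟨hbot x, hx, subset_closure (subset_convexHull ℝ _ ?_)⟩
  have hmem : (x, (g x).toReal) ∈ epi g := EReal.le_coe_toReal hx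
  -- Constant sequences suffice: the subgradient inequality makes the functional a regular normal
  -- without any error term.
  refine ⟨hmem, fun _ => _, fun _ => _, tendsto_const_nhds, tendsto_const_nhds,
    fun _ => ⟨hmem, fun ε hε => ?_⟩⟩
  filter_upwards [self_mem_nhdsWithin] with w hw
  have hw : g w.1 ≤ (w.2 : EReal) := hw
  have hwtop : g w.1 ≠ ⊤ := ne_top_of_le_ne_top (EReal.coe_ne_top _) hw
  have h1 := hv w.1 hwtop
  have h2 : (g w.1).toReal ≤ w.2 := by
    rwa [← EReal.coe_le_coe_iff, EReal.coe_toReal hwtop (hbot _)]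
  have h3 : 0 ≤ ε * ‖w - (x, (g x).toReal)‖ := by positivity
  simp only [sub_apply, ContinuousLinearMap.comp_apply,
    ContinuousLinearMap.coe_fst', ContinuousLinearMap.coe_snd', innerSL_apply_apply, Prod.fst_sub,
    Prod.snd_sub]
  linarith

/-- The real-valued restriction of a convex function to its domain is convex. -/
theorem convexOn_toReal {g : E → EReal} (hg : Convex ℝ (epi g)) (hbot : ∀ y, g y ≠ ⊥) :
    ConvexOn ℝ (effDom g) fun x => (g x).toReal := by
  have key : ∀ x ∈ effDom g, ∀ y ∈ effDom g, ∀ a b : ℝ, 0 ≤ a → 0 ≤ b → a + b = 1 →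
      g (a • x + b • y) ≤ ((a * (g x).toReal + b * (g y).toReal : ℝ) : EReal) := by
    intro x hx y hy a b ha hb hab
    exact hg (x := (x, (g x).toReal)) (y := (y, (g y).toReal)) (EReal.le_coe_toReal (ne_of_lt hx))
      (EReal.le_coe_toReal (ne_of_lt hy)) ha hb hab
  refine ⟨fun x hx y hy a b ha hb hab => ?_, fun x hx y hy a b ha hb hab => ?_⟩
  · exact (key x hx y hy a b ha hb hab).trans_lt (EReal.coe_lt_top _)
  · have h := key x hx y hy a b ha hb hab
    have htop := ne_top_of_le_ne_top (EReal.coe_ne_top _) h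
    rwa [← EReal.coe_toReal htop (hbot _), EReal.coe_le_coe_iff] at h

end Subgradients

end ProxRR

/-! ### Chain rules and the energy estimate. -/

theorem AbsolutelyContinuousOnInterval.finsetSum {ι F : Type*} [NormedAddCommGroup F]
    {φ : ι → ℝ → F} {a b : ℝ} (s : Finset ι)
    (h : ∀ i ∈ s, AbsolutelyContinuousOnInterval (φ i) a b) :
    AbsolutelyContinuousOnInterval (fun t => ∑ i ∈ s, φ i t) a b := by
  classical
  induction s using Finset.induction_on with
  | empty =>
    simp only [Finset.sum_empty]
    exact (LipschitzWith.const (0 : F)).lipschitzOnWith.absolutelyContinuousOnInterval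
  | insert i s hi ih =>
    simp only [Finset.sum_insert hi]
    exact (h i (Finset.mem_insert_self i s)).fun_add
      (ih fun j hj => h j (Finset.mem_insert_of_mem hj))

/-- Dilations preserve null sets; this carries the chain rule from `[0, 1]` to `[0, b]`. -/
theorem ae_restrict_Ioo_of_comp_const_mul {p : ℝ → Prop} {b : ℝ} (hb : 0 < b)
    (h : ∀ᵐ s ∂(volume.restrict (Ioo (0 : ℝ) 1)), p (b * s)) :
    ∀ᵐ t ∂(volume.restrict (Ioo (0 : ℝ) b)), p t := by
  rw [ae_restrict_iff' measurableSet_Ioo] at h ⊢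
  have hq : Measure.QuasiMeasurePreserving (fun t : ℝ => b⁻¹ * t) volume volume := by
    refine ⟨measurable_const_mul _, ?_⟩
    rw [Real.map_volume_mul_left (inv_ne_zero hb.ne')]
    exact Measure.smul_absolutelyContinuous
  filter_upwards [hq.ae h] with t ht hmem
  have := ht ⟨by have := hmem.1; positivity, by
    rw [inv_mul_lt_iff₀ hb, mul_one]; exact hmem.2⟩
  rwa [mul_inv_cancel_left₀ hb.ne'] at this

namespace ProxRR

section Energy

variable {E : Type*} [NormedAddCommGroup E] [InnerProductSpace ℝ E]

/-- The chain rule of a conservative field along curves on `[0, b]`. -/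
theorem IsConservativeField.chain_rule_Icc {Φ : E → EReal} {D : E → Set E}
    (hD : IsConservativeField Φ D) {x : ℝ → E} {b : ℝ} (hb : 0 < b)
    (hx : AbsolutelyContinuousOnInterval x 0 b) (hne : ∀ t ∈ Icc 0 b, (D (x t)).Nonempty) :
    ∀ᵐ t ∂(volume.restrict (Ioo (0 : ℝ) b)), ∃ x' : E, HasDerivAt x x' t ∧
      ∀ v ∈ D (x t), HasDerivAt (fun s => (Φ (x s)).toReal) ⟪v, x'⟫ t := by
  refine ae_restrict_Ioo_of_comp_const_mul hb ?_
  filter_upwards [hD.chain_rule _ (hx.comp_const_mul hb) fun t ht =>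
    hne _ ⟨mul_nonneg hb.le ht.1, mul_le_of_le_one_right hb.le ht.2⟩] with s hs
  obtain ⟨x', hx', hv⟩ := hs
  have hinv : HasDerivAt (fun t : ℝ => b⁻¹ * t) b⁻¹ (b * s) := by
    simpa using (hasDerivAt_id (b * s)).const_mul b⁻¹
  have hs' : s = b⁻¹ * (b * s) := (inv_mul_cancel_left₀ hb.ne' s).symm
  refine ⟨b⁻¹ • x', ?_, fun v hvD => ?_⟩
  · rw [hs'] at hx'
    convert HasDerivAt.scomp (b * s) hx' hinv using 1
    funext t
    simp [mul_inv_cancel_left₀ hb.ne']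
  · have hv := hv v hvD
    rw [hs'] at hv
    have key := HasDerivAt.scomp (b * s) hv hinv
    simp only [Function.comp_def, mul_inv_cancel_left₀ hb.ne', smul_eq_mul] at key
    rwa [inner_smul_right]

/-- Along a differentiable curve a subgradient determines the derivative. -/
theorem hasDerivAt_comp_of_subgradient {γ : E → ℝ} {x : ℝ → E} {t : ℝ} {x' w : E}
    (hx : HasDerivAt x x' t) (hγ : DifferentiableAt ℝ (fun s => γ (x s)) t)
    (hw : ∀ᶠ s in 𝓝 t, γ (x t) + ⟪w, x s - x t⟫ ≤ γ (x s)) :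
    HasDerivAt (fun s => γ (x s)) ⟪w, x'⟫ t := by
  have h1 : HasDerivAt (fun s => ⟪w, x s - x t⟫) ⟪w, x'⟫ t := by
    simpa using (hasDerivAt_const t w).inner ℝ (hx.sub_const (x t))
  have h2 := hγ.hasDerivAt.sub h1
  -- Subtracting the affine minorant leaves a function with a minimum at `t`, whose derivative must
  -- vanish.
  have hmin : IsLocalMin ((fun s => γ (x s)) - fun s => ⟪w, x s - x t⟫) t := by
    filter_upwards [hw] with s hs
    simp only [Pi.sub_apply, sub_self, inner_zero_right, sub_zero]
    linarith
  rw [← sub_eq_zero.1 (hmin.hasDerivAt_eq_zero h2)]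
  exact hγ.hasDerivAt

variable [FiniteDimensional ℝ E] {N : ℕ} {f : Fin N → E → ℝ} {D : Fin N → E → Set E}
  {g : E → EReal}

/-- The objective decreases along curves of negative subgradients, which gives a bound for the
length of such curves and the integral representation. -/
theorem StandingAssumption.energy_estimate (h : StandingAssumption f D g) {m : ℝ}
    (hm : ∀ y ∈ effDom g, m ≤ ∑ i, f i y + (g y).toReal) {x : ℝ → E} {b : ℝ} (hb : 0 < b)
    (hx : AbsolutelyContinuousOnInterval x 0 b) (hdom : ∀ t ∈ Icc 0 b, x t ∈ effDom g)
    (hsol : ∀ᵐ t ∂(volume.restrict (Ioo (0 : ℝ) b)), ∃ v ∈ ∑ i, D i (x t), ∃ w : E,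
      (∀ s ∈ Icc 0 b, (g (x t)).toReal + ⟪w, x s - x t⟫ ≤ (g (x s)).toReal) ∧
      HasDerivAt x (-(v + w)) t) :
    IntervalIntegrable (deriv x) volume 0 b ∧
    (∀ t ∈ Icc 0 b, x t = x 0 + ∫ s in (0 : ℝ)..t, deriv x s) ∧
    ∫ s in (0 : ℝ)..b, ‖deriv x s‖ ≤ (∑ i, f i (x 0) + (g (x 0)).toReal - m + b) / 2 := by
  have := FiniteDimensional.complete ℝ E
  have hIcc : uIcc 0 b = Icc 0 b := uIcc_of_le hb.le
  have hγ : AbsolutelyContinuousOnInterval (fun t => (g (x t)).toReal) 0 b :=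
    hx.locallyLipschitzOn_comp h.g_locLipschitz.2 (hIcc ▸ hdom)
  have hf : AbsolutelyContinuousOnInterval (fun t => ∑ i, f i (x t)) 0 b :=
    AbsolutelyContinuousOnInterval.finsetSum _ fun i _ => hx.locallyLipschitzOn_comp
      (s := univ) (locallyLipschitzOn_univ.2 (h.f_locLipschitz i)) fun _ _ => mem_univ _
  have hφ := hf.fun_add hγ
  have hchain := fun i => (h.D_conservative i).chain_rule_Icc hb hx fun t _ => h.D_nonempty i (x t)
  simp only [EReal.toReal_coe] at hchain
  have hdiff : ∀ᵐ t ∂(volume.restrict (Ioo (0 : ℝ) b)),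
      DifferentiableAt ℝ (fun t => (g (x t)).toReal) t := by
    rw [ae_restrict_iff' measurableSet_Ioo]
    filter_upwards [hγ.ae_differentiableAt] with t ht hmem
    exact ht (hIcc ▸ Ioo_subset_Icc_self hmem)
  have hder : ∀ᵐ t ∂(volume.restrict (Ioo (0 : ℝ) b)), HasDerivAt x (deriv x t) t ∧
      deriv (fun t => ∑ i, f i (x t) + (g (x t)).toReal) t = -‖deriv x t‖ ^ 2 := by
    filter_upwards [ae_all_iff.2 hchain, hdiff, hsol, ae_restrict_mem measurableSet_Ioo]
      with t h1 h2 h3 ht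
    obtain ⟨v, hv, w, hw, hxt⟩ := h3
    obtain ⟨v, hvD, rfl⟩ := (Set.mem_fintype_sum _ _).1 hv
    have hx' := hxt.differentiableAt.hasDerivAt
    refine ⟨hx', ?_⟩
    have hfi : ∀ i, HasDerivAt (fun s => f i (x s)) ⟪v i, deriv x t⟫ t := by
      intro i
      obtain ⟨x', hxx', hall⟩ := h1 i
      rw [hxx'.deriv]
      exact hall _ (hvD i)
    have hgt := hasDerivAt_comp_of_subgradient (γ := fun y => (g y).toReal) (w := w) hx' h2 (by
      filter_upwards [Ioo_mem_nhds ht.1 ht.2] with s hs using hw s (Ioo_subset_Icc_self hs))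
    rw [((HasDerivAt.fun_sum fun i _ => hfi i).fun_add hgt).deriv, ← sum_inner, ← inner_add_left,
      ← real_inner_self_eq_norm_sq, ← inner_neg_left]
    congr 1
    rw [hxt.deriv, neg_neg]
  have hae : ∀ {p : ℝ → Prop}, (∀ᵐ t ∂(volume.restrict (Ioo (0 : ℝ) b)), p t) →
      ∀ᵐ t ∂(volume.restrict (uIoc (0 : ℝ) b)), p t := by
    intro p hp
    rwa [uIoc_of_le hb.le, ← Measure.restrict_congr_set Ioo_ae_eq_Ioc]
  -- The squared speed is minus the derivative of an absolutely continuous function, hence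
  -- integrable.
  have hsq : IntervalIntegrable (fun t => ‖deriv x t‖ ^ 2) volume 0 b := by
    refine hφ.intervalIntegrable_deriv.neg.congr_ae (hae ?_)
    filter_upwards [hder] with t ht
    rw [Pi.neg_apply, ht.2, neg_neg]
  have hyoung : ∀ t, ‖deriv x t‖ ≤ (‖deriv x t‖ ^ 2 + 1) / 2 := fun t => by
    nlinarith [sq_nonneg (‖deriv x t‖ - 1)]
  have hint' : IntervalIntegrable (fun t => (‖deriv x t‖ ^ 2 + 1) / 2) volume 0 b :=
    (hsq.add intervalIntegrable_const).div_const 2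
  have hint : IntervalIntegrable (deriv x) volume 0 b := by
    refine hint'.mono_fun (aestronglyMeasurable_deriv x _) (Eventually.of_forall fun t => ?_)
    exact (hyoung t).trans (Real.le_norm_self _)
  refine ⟨hint, fun t ht => hx.eq_add_integral hb hint (hder.mono fun t ht => ht.1) ht, ?_⟩
  have htotal : ∫ t in (0 : ℝ)..b, ‖deriv x t‖ ^ 2 =
      (∑ i, f i (x 0) + (g (x 0)).toReal) - (∑ i, f i (x b) + (g (x b)).toReal) := by
    have h1 := hφ.integral_deriv_eq_sub
    have h2 : ∫ t in (0 : ℝ)..b, deriv (fun t => ∑ i, f i (x t) + (g (x t)).toReal) t =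
        ∫ t in (0 : ℝ)..b, -‖deriv x t‖ ^ 2 := by
      refine intervalIntegral.integral_congr_ae_restrict (hae ?_)
      filter_upwards [hder] with t ht using ht.2
    rw [h2, intervalIntegral.integral_neg] at h1
    linarith
  have hle := intervalIntegral.integral_mono hb.le hint.norm hint' hyoung
  rw [intervalIntegral.integral_div, intervalIntegral.integral_add hsq intervalIntegrable_const,
    htotal, intervalIntegral.integral_const] at hle
  have hmb := hm (x b) (hdom b ⟨hb.le, le_rfl⟩)
  simp only [sub_zero, smul_eq_mul, mul_one] at hle
  linarith

end Energy

end ProxRR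

/-! ### Limits of one-step schemes. -/

section EulerScheme

variable {E : Type*} [NormedAddCommGroup E] [NormedSpace ℝ E]

/-- Telescoping for a polygon all of whose steps have slope in a convex set. -/
theorem Convex.exists_smul_of_step_mem {Q : Set E} (hQ : Convex ℝ Q) {z u : ℕ → E} {η : ℝ}
    (hz : ∀ k, z (k + 1) = z k + η • u k) {i j : ℕ} (hij : i < j)
    (hu : ∀ k, i ≤ k → k < j → u k ∈ Q) : ∃ q ∈ Q, z j - z i = (((j : ℝ) - i) * η) • q := by
  induction j, hij using Nat.le_induction with
  | base =>
    refine ⟨u i, hu i le_rfl (Nat.lt_succ_self i), ?_⟩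
    rw [Nat.succ_eq_add_one, hz, Nat.cast_add_one, add_sub_cancel_left, add_sub_cancel_left,
      one_mul]
  | succ j hij ih =>
    obtain ⟨q, hq, hqz⟩ := ih fun k hk hkj => hu k hk (hkj.trans (Nat.lt_succ_self j))
    have hpos : (0 : ℝ) < (j : ℝ) - i := sub_pos.2 (Nat.cast_lt.2 hij)
    have huj := hu j (Nat.le_of_lt hij) (Nat.lt_succ_self j)
    have hpos' : (0 : ℝ) < (j : ℝ) - i + 1 := by linarith
    refine ⟨(((j : ℝ) - i) / ((j : ℝ) - i + 1)) • q + (1 / ((j : ℝ) - i + 1)) • u j,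
      hQ hq huj (by positivity) (by positivity) (by field_simp), ?_⟩
    have : z (j + 1) - z i = (z j - z i) + η • u j := by rw [hz]; abel
    rw [this, hqz, smul_add, smul_smul, smul_smul]
    push_cast
    congr 2 <;> field_simp <;> ring

/-- A ball is convex, so mean slopes over several steps obey the same bound `S`; the limit curve
inherits it as its Lipschitz constant. -/
theorem dist_le_of_step_le {z u : ℕ → E} {η S : ℝ} (hη : 0 ≤ η)
    (hz : ∀ k, z (k + 1) = z k + η • u k) (hu : ∀ k, ‖u k‖ ≤ S) {i j : ℕ} (hij : i ≤ j) :
    dist (z i) (z j) ≤ S * (((j : ℝ) - i) * η) := by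
  rcases hij.eq_or_lt with rfl | hlt
  · simp
  · obtain ⟨q, hq, hqz⟩ := (convex_closedBall (0 : E) S).exists_smul_of_step_mem hz hlt
      fun k _ _ => mem_closedBall_zero_iff.2 (hu k)
    have hpos : (0 : ℝ) ≤ ((j : ℝ) - i) * η :=
      mul_nonneg (sub_nonneg.2 (Nat.cast_le.2 hij)) hη
    rw [dist_comm, dist_eq_norm, hqz, norm_smul, Real.norm_of_nonneg hpos, mul_comm]
    exact mul_le_mul_of_nonneg_right (mem_closedBall_zero_iff.1 hq) hpos

/-- Solutions of a differential inclusion as limits of a one-step scheme in a compact set: if each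
step from `y` to `z` has a slope `u` with `P y z u`, and slopes of steps near `x` are almost in the
closed convex set `G x`, then there is a Lipschitz solution of `x' ∈ G x`. -/
theorem exists_lipschitz_solution_of_steps {K : Set E} (hK : IsCompact K) {S : NNReal}
    {P : E → E → E → Prop} {G : E → Set E}
    (hstep : ∀ η : ℝ, 0 < η → ∀ x ∈ K, ∃ u : E, ‖u‖ ≤ S ∧ x + η • u ∈ K ∧ P x (x + η • u) u)
    (hGclosed : ∀ x ∈ K, IsClosed (G x)) (hGconv : ∀ x ∈ K, Convex ℝ (G x))
    (hGusc : ∀ x ∈ K, ∀ ε : ℝ, 0 < ε → ∃ δ : ℝ, 0 < δ ∧ ∀ y ∈ K, ∀ z ∈ K, dist y x < δ →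
      dist z x < δ → ∀ u, ‖u‖ ≤ S → P y z u → u ∈ Metric.cthickening ε (G x))
    {x₀ : E} (hx₀ : x₀ ∈ K) :
    ∃ x : ℝ → E, x 0 = x₀ ∧ LipschitzOnWith S x (Ici 0) ∧ (∀ t, 0 ≤ t → x t ∈ K) ∧
      ∀ t, 0 < t → ∀ x' : E, HasDerivAt x x' t → x' ∈ G (x t) := by
  choose! U hUn hUK hUP using hstep
  let η : ℕ → ℝ := fun n => 1 / ((n : ℝ) + 1)
  have hη : ∀ n, 0 < η n := fun n => Nat.one_div_pos_of_nat
  let z : ℕ → ℕ → E := fun n k => (fun y => y + η n • U (η n) y)^[k] x₀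
  have hz : ∀ n k, z n (k + 1) = z n k + η n • U (η n) (z n k) := fun n k =>
    Function.iterate_succ_apply' _ _ _
  have hzK : ∀ n k, z n k ∈ K := by
    intro n k
    induction k with
    | zero => exact hx₀
    | succ k ih => rw [hz]; exact hUK _ (hη n) _ ih
  have hzP : ∀ n k, P (z n k) (z n (k + 1)) (U (η n) (z n k)) := fun n k => by
    rw [hz]; exact hUP _ (hη n) _ (hzK n k)
  have hUS : ∀ n k, ‖U (η n) (z n k)‖ ≤ S := fun n k => hUn _ (hη n) _ (hzK n k)
  -- The number of steps of length `η n = 1 / (n + 1)` that fit into time `t`.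
  let m : ℕ → ℝ → ℕ := fun n t => ⌊t * ((n : ℝ) + 1)⌋₊
  have hmono : ∀ n s t, s ≤ t → m n s ≤ m n t := fun n s t hst =>
    Nat.floor_le_floor (mul_le_mul_of_nonneg_right hst (by positivity))
  -- One ultrafilter gives limits at all times simultaneously, in place of an Arzelà–Ascoli
  -- subsequence.
  let L : Filter ℕ := (hyperfilter ℕ : Ultrafilter ℕ)
  have hLtop : L ≤ atTop := Nat.hyperfilter_le_atTop
  have hmη : ∀ t, 0 ≤ t → Tendsto (fun n => (m n t : ℝ) * η n) L (𝓝 t) := by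
    intro t ht
    have h1 := (tendsto_nat_floor_mul_div_atTop (R := ℝ) ht).comp
      (tendsto_atTop_add_const_right atTop (1 : ℝ) tendsto_natCast_atTop_atTop)
    refine (h1.congr fun n => ?_).mono_left hLtop
    simp only [Function.comp_apply, m, η]
    rw [mul_one_div]
  have hηlim : Tendsto η L (𝓝 0) := tendsto_one_div_add_atTop_nhds_zero_nat.mono_left hLtop
  have hlim : ∀ t, ∃ y ∈ K, Tendsto (fun n => z n (m n t)) L (𝓝 y) := by
    intro t
    have := hK.ultrafilter_le_nhds ((hyperfilter ℕ).map fun n => z n (m n t))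
      (by
        rw [Ultrafilter.coe_map, le_principal_iff]
        exact Filter.mem_map.2 (Filter.univ_mem' fun n => hzK n _))
    exact this
  choose x hxK hxlim using hlim
  have hdist : ∀ s t, 0 ≤ s → s ≤ t → dist (x s) (x t) ≤ S * (t - s) := by
    intro s t hs hst
    refine le_of_tendsto_of_tendsto ((hxlim s).dist (hxlim t))
      (((hmη t (hs.trans hst)).sub (hmη s hs)).const_mul (S : ℝ)) (Eventually.of_forall fun n => ?_)
    have := dist_le_of_step_le (hη n).le (hz n) (hUS n) (hmono n s t hst)
    rwa [sub_mul] at this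
  have hlip : LipschitzOnWith S x (Ici 0) := by
    refine LipschitzOnWith.of_dist_le_mul fun s hs t ht => ?_
    rcases le_total s t with hst | hst
    · rw [dist_comm s t, Real.dist_eq, abs_of_nonneg (sub_nonneg.2 hst)]
      exact hdist s t hs hst
    · rw [dist_comm (x s), Real.dist_eq, abs_of_nonneg (sub_nonneg.2 hst)]
      exact hdist t s ht hst
  refine ⟨x, ?_, hlip, fun t _ => hxK t, fun t ht x' hx' => ?_⟩
  · refine tendsto_nhds_unique (hxlim 0) ?_
    have : ∀ n, z n (m n 0) = x₀ := fun n => by simp [m, z]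
    simp only [this]
    exact tendsto_const_nhds
  -- A closed set is the intersection of its closed thickenings, so it is enough to put `x'` in each
  -- of them.
  · rw [← (hGclosed _ (hxK t)).closure_eq, Metric.closure_eq_iInter_cthickening]
    refine mem_iInter₂.2 fun ε hε => ?_
    obtain ⟨δ, hδ, hP⟩ := hGusc _ (hxK t) ε hε
    set Q := Metric.cthickening ε (G (x t)) with hQdef
    have hQ : Convex ℝ Q := (hGconv _ (hxK t)).cthickening ε
    have hQc : IsClosed Q := Metric.isClosed_cthickening
    -- difference quotients over short intervals after `t` belong to `Q`
    have hquot : ∀ r, t < r → S * (r - t) < δ / 2 → (r - t)⁻¹ • (x r - x t) ∈ Q := by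
      intro r hr hrδ
      have hlen := (hmη r (ht.le.trans hr.le)).sub (hmη t ht.le)
      have hpos : 0 < r - t := sub_pos.2 hr
      have hq := (hlen.inv₀ hpos.ne').smul ((hxlim r).sub (hxlim t))
      refine hQc.mem_of_tendsto hq ?_
      have e1 := hlen.eventually (lt_mem_nhds hpos)
      have e2 : ∀ᶠ n in L, dist (z n (m n t)) (x t) +
          S * ((m n r : ℝ) * η n - (m n t : ℝ) * η n) < δ := by
        have := ((hxlim t).dist (tendsto_const_nhds (x := x t))).add (hlen.const_mul (S : ℝ))
        rw [dist_self, zero_add] at this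
        exact this.eventually (gt_mem_nhds (by linarith))
      filter_upwards [e1, e2] with n hn1 hn2
      rw [← sub_mul] at hn1 hn2 ⊢
      have hlt : m n t < m n r := by
        have := (pos_iff_pos_of_mul_pos hn1).2 (hη n)
        exact_mod_cast sub_pos.1 this
      have hnear : ∀ k, m n t ≤ k → k ≤ m n r → dist (z n k) (x t) < δ := by
        intro k hk1 hk2
        have h1 := dist_le_of_step_le (hη n).le (hz n) (hUS n) hk1
        have h2 : (k : ℝ) ≤ m n r := Nat.cast_le.2 hk2
        have h3 : (S : ℝ) * (((k : ℝ) - m n t) * η n) ≤ S * (((m n r : ℝ) - m n t) * η n) :=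
          mul_le_mul_of_nonneg_left
            (mul_le_mul_of_nonneg_right (by linarith) (hη n).le) S.coe_nonneg
        have h4 := dist_triangle_left (z n k) (x t) (z n (m n t))
        linarith
      obtain ⟨q, hqQ, hqz⟩ := hQ.exists_smul_of_step_mem (hz n) hlt fun k hk1 hk2 =>
        hP _ (hzK n k) _ (hzK n (k + 1)) (hnear k hk1 hk2.le) (hnear (k + 1) (by omega) hk2) _
          (hUS n k) (hzP n k)
      rw [hqz, smul_smul, inv_mul_cancel₀ hn1.ne', one_smul]
      exact hqQ
    have hslope := hx'.hasDerivWithinAt (s := Ioi t)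
    rw [hasDerivWithinAt_iff_tendsto_slope' (notMem_Ioi.2 le_rfl)] at hslope
    refine hQc.mem_of_tendsto hslope ?_
    have hsmall : ∀ᶠ r in 𝓝[>] t, (S : ℝ) * (r - t) < δ / 2 := by
      have : Tendsto (fun r => (S : ℝ) * (r - t)) (𝓝 t) (𝓝 ((S : ℝ) * (t - t))) :=
        Continuous.tendsto (by fun_prop) t
      rw [sub_self, mul_zero] at this
      exact (this.mono_left nhdsWithin_le_nhds).eventually (gt_mem_nhds (by positivity))
    filter_upwards [hsmall, self_mem_nhdsWithin] with r h1 h2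
    rw [slope_def_module]
    exact hquot r h2 h1

end EulerScheme

/-! ### Proximal steps and upper semicontinuity. -/

namespace ProxRR

section Boundedness

variable {E : Type*} [NormedAddCommGroup E]

/-- A locally bounded mapping is bounded on compact sets. -/
theorem IsLocBounded.exists_norm_le {D : E → Set E} (hD : IsLocBounded D) {K : Set E}
    (hK : IsCompact K) : ∃ M : ℝ, ∀ y ∈ K, ∀ v ∈ D y, ‖v‖ ≤ M := by
  refine hK.induction_on (p := fun s => ∃ M : ℝ, ∀ y ∈ s, ∀ v ∈ D y, ‖v‖ ≤ M)
    ⟨0, fun _ h => absurd h (notMem_empty _)⟩ ?_ ?_ ?_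
  · rintro s t hst ⟨M, hM⟩
    exact ⟨M, fun y hy => hM y (hst hy)⟩
  · rintro s t ⟨M, hM⟩ ⟨M', hM'⟩
    refine ⟨max M M', fun y hy v hv => ?_⟩
    rcases hy with hy | hy
    · exact (hM y hy v hv).trans (le_max_left _ _)
    · exact (hM' y hy v hv).trans (le_max_right _ _)
  · intro y _
    obtain ⟨U, hU, hb⟩ := hD y
    obtain ⟨M, hM⟩ := hb.exists_norm_le
    exact ⟨U, mem_nhdsWithin_of_mem_nhds hU, M, fun z hz v hv => hM v (mem_biUnion hz hv)⟩

/-- A fixed ultrafilter makes several bounded sequences converge together, with no successive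
extraction of subsequences. -/
theorem exists_tendsto_hyperfilter_of_norm_le [ProperSpace E] {a : ℕ → E} {M : ℝ}
    (h : ∀ n, ‖a n‖ ≤ M) : ∃ l, Tendsto a (hyperfilter ℕ : Filter ℕ) (𝓝 l) := by
  have := (isCompact_closedBall (0 : E) M).ultrafilter_le_nhds ((hyperfilter ℕ).map a)
    (by
      rw [Ultrafilter.coe_map, le_principal_iff]
      exact Filter.mem_map.2 (Filter.univ_mem' fun n => mem_closedBall_zero_iff.2 (h n)))
  obtain ⟨l, _, hl⟩ := this
  exact ⟨l, hl⟩

end Boundedness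

section LocalExistence

variable {E : Type*} [NormedAddCommGroup E] [InnerProductSpace ℝ E]

/-- The subgradients at `x` of the restriction of `γ` to the set `K`. -/
def restrictedSubgradients (γ : E → ℝ) (K : Set E) (x : E) : Set E :=
  {w | ∀ z ∈ K, γ x + ⟪w, z - x⟫ ≤ γ z}

theorem isClosed_restrictedSubgradients (γ : E → ℝ) (K : Set E) (x : E) :
    IsClosed (restrictedSubgradients γ K x) := by
  have : restrictedSubgradients γ K x = ⋂ z ∈ K, {w | γ x + ⟪w, z - x⟫ ≤ γ z} := by
    ext w; simp [restrictedSubgradients]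
  rw [this]
  exact isClosed_biInter fun z _ => isClosed_le (by fun_prop) continuous_const

theorem convex_restrictedSubgradients (γ : E → ℝ) (K : Set E) (x : E) :
    Convex ℝ (restrictedSubgradients γ K x) := by
  intro w₁ h₁ w₂ h₂ a b ha hb hab z hz
  rw [inner_add_left, real_inner_smul_left, real_inner_smul_left]
  have e : a * γ x + b * γ x = γ x := by rw [← add_mul, hab, one_mul]
  have e' : a * γ z + b * γ z = γ z := by rw [← add_mul, hab, one_mul]
  nlinarith [mul_le_mul_of_nonneg_left (h₁ z hz) ha, mul_le_mul_of_nonneg_left (h₂ z hz) hb]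

/-- A subgradient of the restriction to a ball around an interior point is a subgradient. -/
theorem restrictedSubgradients_of_ball {γ : E → ℝ} {C : Set E} (hγ : ConvexOn ℝ C γ) {c x w : E}
    {R : ℝ} (hx : x ∈ C) (hxR : dist x c < R)
    (hw : w ∈ restrictedSubgradients γ (C ∩ Metric.closedBall c R) x) :
    w ∈ restrictedSubgradients γ C x := by
  intro y hy
  have hlim : Tendsto (fun t : ℝ => dist (x + t • (y - x)) c) (𝓝[>] 0) (𝓝 (dist x c)) := by
    have : Tendsto (fun t : ℝ => dist (x + t • (y - x)) c) (𝓝 0)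
        (𝓝 (dist (x + (0 : ℝ) • (y - x)) c)) := Continuous.tendsto (by fun_prop) 0
    rw [zero_smul, add_zero] at this
    exact this.mono_left nhdsWithin_le_nhds
  obtain ⟨t, ht, ht0, ht1⟩ := ((hlim.eventually (gt_mem_nhds hxR)).and
    (Ioo_mem_nhdsGT (zero_lt_one (α := ℝ)))).exists
  have hcomb : x + t • (y - x) = (1 - t) • x + t • y := by
    rw [smul_sub, sub_smul, one_smul]; abel
  have h1 := hw (x + t • (y - x))
    ⟨hγ.1.add_smul_sub_mem hx hy ⟨ht0.le, ht1.le⟩, Metric.mem_closedBall.2 ht.le⟩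
  have h2 := hγ.2 hx hy (sub_nonneg.2 ht1.le) ht0.le (sub_add_cancel 1 t)
  rw [← hcomb, smul_eq_mul, smul_eq_mul] at h2
  rw [add_sub_cancel_left, real_inner_smul_right] at h1
  have h3 : t * (γ x + ⟪w, y - x⟫) ≤ t * γ y := by linarith
  exact le_of_mul_le_mul_left h3 ht0

/-- The proximal gradient step. -/
theorem exists_proximal_step {K : Set E} (hK : IsCompact K) {γ : E → ℝ} (hγ : ConvexOn ℝ K γ)
    {L : NNReal} (hL : LipschitzOnWith L γ K) {x : E} (hx : x ∈ K) (v : E) {η : ℝ} (hη : 0 < η) :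
    ∃ w : E, x + η • -(v + w) ∈ K ∧ w ∈ restrictedSubgradients γ K (x + η • -(v + w)) ∧
      ‖v + w‖ ≤ L + ‖v‖ := by
  -- The minimiser over `K` of this function is the proximal point of the gradient step `x - η • v`;
  -- `w` below is read off from the optimality condition.
  have hcont : ContinuousOn (fun y => γ y + ‖y - x + η • v‖ ^ 2 / (2 * η)) K :=
    hL.continuousOn.add (Continuous.continuousOn (by fun_prop))
  obtain ⟨y, hy, hmin⟩ := hK.exists_isMinOn ⟨x, hx⟩ hcont
  set w : E := -(η⁻¹ • (y - x) + v) with hwdef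
  have hxy : x + η • -(v + w) = y := by
    have : -(v + w) = η⁻¹ • (y - x) := by rw [hwdef]; abel
    rw [this, smul_inv_smul₀ hη.ne', add_sub_cancel]
  have hres : y - x + η • v = -(η • w) := by
    rw [← hxy]; simp only [smul_neg, smul_add]; abel
  have hw : w ∈ restrictedSubgradients γ K y := by
    intro z hz
    -- Compare `y` with a point on the segment towards `z`: after division by `t` the quadratic
    -- error is of order `t` and disappears in the limit.
    have key : ∀ t : ℝ, t ∈ Ioo (0 : ℝ) 1 →
        γ y + ⟪w, z - y⟫ - t * (‖z - y‖ ^ 2 / (2 * η)) ≤ γ z := by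
      rintro t ⟨ht0, ht1⟩
      have hcomb : y + t • (z - y) = (1 - t) • y + t • z := by
        rw [smul_sub, sub_smul, one_smul]; abel
      have h1 : γ y + ‖y - x + η • v‖ ^ 2 / (2 * η) ≤ γ (y + t • (z - y)) +
          ‖y + t • (z - y) - x + η • v‖ ^ 2 / (2 * η) :=
        hmin (hγ.1.add_smul_sub_mem hy hz ⟨ht0.le, ht1.le⟩)
      have h2 := hγ.2 hy hz (sub_nonneg.2 ht1.le) ht0.le (sub_add_cancel 1 t)
      rw [← hcomb, smul_eq_mul, smul_eq_mul] at h2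
      have h3 : y + t • (z - y) - x + η • v = -(η • w) + t • (z - y) := by
        rw [← hres]; abel
      rw [h3, hres, norm_add_sq_real, inner_neg_left, real_inner_smul_left, real_inner_smul_right,
        norm_smul t, Real.norm_of_nonneg ht0.le] at h1
      have h4 : (‖-(η • w)‖ ^ 2 + 2 * -(η * (t * ⟪w, z - y⟫)) + (t * ‖z - y‖) ^ 2) / (2 * η) =
          ‖-(η • w)‖ ^ 2 / (2 * η) - t * ⟪w, z - y⟫ + t * (t * (‖z - y‖ ^ 2 / (2 * η))) := by
        field_simp
        ring
      rw [h4] at h1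
      have h5 : t * (γ y + ⟪w, z - y⟫ - t * (‖z - y‖ ^ 2 / (2 * η))) ≤ t * γ z := by linarith
      exact le_of_mul_le_mul_left h5 ht0
    have hlim : Tendsto (fun t : ℝ => γ y + ⟪w, z - y⟫ - t * (‖z - y‖ ^ 2 / (2 * η))) (𝓝[>] 0)
        (𝓝 (γ y + ⟪w, z - y⟫)) := by
      have : Tendsto (fun t : ℝ => γ y + ⟪w, z - y⟫ - t * (‖z - y‖ ^ 2 / (2 * η))) (𝓝 0)
          (𝓝 (γ y + ⟪w, z - y⟫ - 0 * (‖z - y‖ ^ 2 / (2 * η)))) := Continuous.tendsto (by fun_prop) 0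
      rw [zero_mul, sub_zero] at this
      exact this.mono_left nhdsWithin_le_nhds
    refine le_of_tendsto hlim ?_
    filter_upwards [Ioo_mem_nhdsGT (zero_lt_one (α := ℝ))] with t ht using key t ht
  refine ⟨w, by rwa [hxy], by rwa [hxy], ?_⟩
  -- The subgradient inequality at `y`, tested at the old point `x`, gives `⟪w, v + w⟫ ≤ L ‖v + w‖`.
  -- Adding `⟪v, v + w⟫` bounds `‖v + w‖²`.
  have hsub := hw x hx
  have hdiff : x - y = η • (v + w) := by rw [← hxy]; simp
  have hlip := hL.dist_le_mul x hx y hy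
  rw [dist_eq_norm x y, hdiff, norm_smul, Real.norm_of_nonneg hη.le, Real.dist_eq] at hlip
  rw [hdiff, real_inner_smul_right] at hsub
  have h1 : η * ⟪w, v + w⟫ ≤ η * (L * ‖v + w‖) := by linarith [le_abs_self (γ x - γ y)]
  have h2 : ⟪w, v + w⟫ ≤ L * ‖v + w‖ := le_of_mul_le_mul_left h1 hη
  have h3 : ‖v + w‖ ^ 2 = ⟪v, v + w⟫ + ⟪w, v + w⟫ := by
    rw [← inner_add_left, real_inner_self_eq_norm_sq]
  have h4 := real_inner_le_norm v (v + w)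
  rcases (norm_nonneg (v + w)).eq_or_lt with h0 | h0
  · rw [← h0]; positivity
  · nlinarith

variable [FiniteDimensional ℝ E] {N : ℕ} {f : Fin N → E → ℝ} {D : Fin N → E → Set E}
  {g : E → EReal}

/-- Upper semicontinuity of the sum of closed locally bounded mappings with the subgradients of a
restricted function. -/
theorem exists_forall_mem_cthickening (hclosed : ∀ i, IsClosed (graph (D i)))
    {K : Set E} {M : Fin N → ℝ} (hM : ∀ i, ∀ y ∈ K, ∀ v ∈ D i y, ‖v‖ ≤ M i) {γ : E → ℝ}
    (hγ : ContinuousOn γ K) (S : ℝ) {x : E} (hx : x ∈ K) {ε : ℝ} (hε : 0 < ε) :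
    ∃ δ : ℝ, 0 < δ ∧ ∀ y ∈ K, ∀ z ∈ K, dist y x < δ → dist z x < δ → ∀ u, ‖u‖ ≤ S →
      (∃ v ∈ ∑ i, D i y, ∃ w ∈ restrictedSubgradients γ K z, u = -(v + w)) →
      u ∈ Metric.cthickening ε (-(∑ i, D i x + restrictedSubgradients γ K x)) := by
  have : ProperSpace E := FiniteDimensional.proper ℝ E
  by_contra! hcon
  choose y hyK z hzK hy hz u hu hE hnot using
    fun n : ℕ => hcon (1 / ((n : ℝ) + 1)) Nat.one_div_pos_of_nat
  choose v hv w hw huvw using hE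
  simp only [Set.mem_fintype_sum] at hv
  choose v' hv' hvsum using hv
  have hlim0 := (tendsto_one_div_add_atTop_nhds_zero_nat (𝕜 := ℝ)).mono_left
    Nat.hyperfilter_le_atTop
  have hyx : Tendsto y (hyperfilter ℕ : Filter ℕ) (𝓝 x) := tendsto_iff_dist_tendsto_zero.2
    (squeeze_zero (fun _ => dist_nonneg) (fun n => (hy n).le) hlim0)
  have hzx : Tendsto z (hyperfilter ℕ : Filter ℕ) (𝓝[K] x) := tendsto_nhdsWithin_iff.2
    ⟨tendsto_iff_dist_tendsto_zero.2
      (squeeze_zero (fun _ => dist_nonneg) (fun n => (hz n).le) hlim0), Eventually.of_forall hzK⟩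
  choose vl hvl using fun i => exists_tendsto_hyperfilter_of_norm_le
    (a := fun n => v' n i) (M := M i) fun n => hM i _ (hyK n) _ (hv' n i)
  obtain ⟨ul, hul⟩ := exists_tendsto_hyperfilter_of_norm_le hu
  have hvlim : Tendsto v (hyperfilter ℕ : Filter ℕ) (𝓝 (∑ i, vl i)) := by
    have := tendsto_finsetSum Finset.univ fun i _ => hvl i
    exact this.congr fun n => hvsum n
  -- No a priori bound on subgradients is available; `w = -u - v` converges because `u` and `v` do.
  have hwlim : Tendsto w (hyperfilter ℕ : Filter ℕ) (𝓝 (-ul - ∑ i, vl i)) := by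
    refine (hul.neg.sub hvlim).congr fun n => ?_
    rw [huvw n, neg_neg, add_sub_cancel_left]
  have hmem : ul ∈ -(∑ i, D i x + restrictedSubgradients γ K x) := by
    rw [Set.mem_neg]
    refine Set.mem_add.2 ⟨∑ i, vl i, (Set.mem_fintype_sum _ _).2 ⟨vl, fun i => ?_, rfl⟩,
      -ul - ∑ i, vl i, fun y' hy' => ?_, by abel⟩
    · exact (hclosed i).mem_of_tendsto (hyx.prodMk_nhds (hvl i))
        (Eventually.of_forall fun n => hv' n i)
    · refine le_of_tendsto (((hγ x hx).tendsto.comp hzx).add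
        (hwlim.inner (tendsto_const_nhds.sub (hzx.mono_right nhdsWithin_le_nhds))))
        (Eventually.of_forall fun n => hw n y' hy')
  have hnhds : Metric.cthickening ε (-(∑ i, D i x + restrictedSubgradients γ K x)) ∈ 𝓝 ul :=
    mem_of_superset (Metric.closedBall_mem_nhds ul hε)
      (Metric.closedBall_subset_cthickening hmem ε)
  obtain ⟨n, hn⟩ := (hul.eventually hnhds).exists
  exact hnot n hn

end LocalExistence

end ProxRR

/-! ### Velocities and their concatenation. -/

namespace ProxRR

section Velocities

variable {E : Type*} [NormedAddCommGroup E] [InnerProductSpace ℝ E]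

/-- `u` is the velocity on `[0, T]` of a solution of `x' ∈ -D(x)` that starts at `x₀`. -/
def IsVelocity (D : E → Set E) (T : ℝ) (x₀ : E) (u : ℝ → E) : Prop :=
  IntervalIntegrable u volume 0 T ∧
  ∀ᵐ t ∂(volume.restrict (Ioo (0 : ℝ) T)), -u t ∈ D (x₀ + ∫ s in (0 : ℝ)..t, u s)

variable {D : E → Set E} {x₀ : E} {u v : ℝ → E} {T T' : ℝ}

/-- End points are null, so the values of a glued velocity at the seams are irrelevant. -/
theorem integral_congr_of_eqOn_Ioo (huv : EqOn u v (Ioo 0 T)) {t : ℝ} (ht0 : 0 ≤ t)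
    (ht : t ≤ T) : ∫ s in (0 : ℝ)..t, u s = ∫ s in (0 : ℝ)..t, v s := by
  rw [intervalIntegral.integral_of_le ht0, intervalIntegral.integral_of_le ht0,
    integral_Ioc_eq_integral_Ioo, integral_Ioc_eq_integral_Ioo]
  exact setIntegral_congr_fun measurableSet_Ioo fun s hs => huv ⟨hs.1, hs.2.trans_le ht⟩

theorem IsVelocity.congr (hT : 0 ≤ T) (hu : IsVelocity D T x₀ u) (huv : EqOn u v (Ioo 0 T)) :
    IsVelocity D T x₀ v := by
  refine ⟨hu.1.congr_ae ?_, ?_⟩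
  · rw [uIoc_of_le hT, ← Measure.restrict_congr_set Ioo_ae_eq_Ioc]
    exact (ae_restrict_mem measurableSet_Ioo).mono fun t ht => huv ht
  · filter_upwards [hu.2, ae_restrict_mem measurableSet_Ioo] with t ht hmem
    rwa [← huv hmem, ← integral_congr_of_eqOn_Ioo huv hmem.1.le hmem.2.le]

theorem IsVelocity.mono (hT : 0 ≤ T) (hTT' : T ≤ T') (hu : IsVelocity D T' x₀ u) :
    IsVelocity D T x₀ u :=
  ⟨hu.1.mono_set (by
      rw [uIcc_of_le hT, uIcc_of_le (hT.trans hTT')]; exact Icc_subset_Icc_right hTT'),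
    ae_restrict_of_ae_restrict_of_subset (Ioo_subset_Ioo_right hTT') hu.2⟩

/-- Follow `u` up to time `T` and then `v`. -/
noncomputable def concat {X : Type*} (T : ℝ) (u v : ℝ → X) (t : ℝ) : X :=
  if t < T then u t else v (t - T)

theorem concat_eqOn {X : Type*} {T : ℝ} {u v : ℝ → X} : EqOn u (concat T u v) (Ioo 0 T) := fun _ ht => (if_pos ht.2).symm

/-- Gluing velocities instead of curves makes the joined curve absolutely continuous automatically.
The second conclusion locates it after the seam. -/
theorem IsVelocity.concat (hT : 0 ≤ T) (hT' : 0 ≤ T') (hu : IsVelocity D T x₀ u)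
    (hv : IsVelocity D T' (x₀ + ∫ s in (0 : ℝ)..T, u s) v) :
    IsVelocity D (T + T') x₀ (concat T u v) ∧ ∀ t ∈ Icc 0 T',
      ∫ s in (0 : ℝ)..(T + t), ProxRR.concat T u v s =
        (∫ s in (0 : ℝ)..T, u s) + ∫ s in (0 : ℝ)..t, v s := by
  have hu' := hu.congr hT (concat_eqOn (v := v))
  have hvT : ∀ t, T ≤ t → ProxRR.concat T u v t = v (t - T) := fun t ht => if_neg (not_lt.2 ht)
  have hshift : ∀ t ∈ Icc 0 T', IntervalIntegrable (ProxRR.concat T u v) volume T (T + t) := by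
    intro t ht
    have h1 : IntervalIntegrable v volume 0 t := hv.1.mono_set (by
      rw [uIcc_of_le ht.1, uIcc_of_le hT']; exact Icc_subset_Icc_right ht.2)
    have h2 := h1.comp_sub_right T
    rw [zero_add, add_comm t] at h2
    refine h2.congr_ae ?_
    rw [uIoc_of_le (by linarith [ht.1])]
    exact (ae_restrict_mem measurableSet_Ioc).mono fun s hs => (hvT s hs.1.le).symm
  have hint : ∀ t ∈ Icc 0 T', ∫ s in (0 : ℝ)..(T + t), ProxRR.concat T u v s =
      (∫ s in (0 : ℝ)..T, u s) + ∫ s in (0 : ℝ)..t, v s := by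
    intro t ht
    rw [← intervalIntegral.integral_add_adjacent_intervals hu'.1 (hshift t ht),
      ← integral_congr_of_eqOn_Ioo concat_eqOn hT le_rfl]
    congr 1
    have h1 : ∫ s in T..(T + t), ProxRR.concat T u v s = ∫ s in T..(T + t), v (s - T) := by
      refine intervalIntegral.integral_congr fun s hs => hvT s ?_
      rw [uIcc_of_le (by linarith [ht.1])] at hs
      exact hs.1
    rw [h1, intervalIntegral.integral_comp_sub_right, sub_self, add_sub_cancel_left]
  refine ⟨⟨hu'.1.trans (hshift T' ⟨hT', le_rfl⟩), ?_⟩, hint⟩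
  have h1 := hu'.2
  have h2 := hv.2
  rw [ae_restrict_iff' measurableSet_Ioo] at h1 h2 ⊢
  have hneT : ∀ᵐ t : ℝ, t ≠ T := by simp [ae_iff, measure_singleton]
  have h3 := (measurePreserving_sub_right volume T).quasiMeasurePreserving.ae h2
  filter_upwards [h1, h3, hneT] with t h1 h3 hne ht
  rcases lt_or_gt_of_ne hne with hlt | hgt
  · exact h1 ⟨ht.1, hlt⟩
  · have hmem : t - T ∈ Ioo 0 T' := ⟨sub_pos.2 hgt, by linarith [ht.2]⟩
    have h4 := hint (t - T) (Ioo_subset_Icc_self hmem)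
    rw [add_sub_cancel] at h4
    rw [hvT t hgt.le, h4, ← add_assoc]
    exact h3 hmem

/-- If unit-time velocities exist from all points of `C`, with end points in `C`, then there are
velocities for all times. -/
theorem exists_isVelocity_of_unit {C : Set E}
    (h : ∀ ξ ∈ C, ∃ u, IsVelocity D 1 ξ u ∧ ξ + ∫ s in (0 : ℝ)..1, u s ∈ C) (hx₀ : x₀ ∈ C) :
    ∃ u, ∀ T, 0 ≤ T → IsVelocity D T x₀ u := by
  choose! W hW hWC using h
  let ξ : ℕ → E := fun n => (fun ζ => ζ + ∫ s in (0 : ℝ)..1, W ζ s)^[n] x₀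
  have hξs : ∀ n, ξ (n + 1) = ξ n + ∫ s in (0 : ℝ)..1, W (ξ n) s := fun n =>
    Function.iterate_succ_apply' _ _ _
  have hξC : ∀ n, ξ n ∈ C := by
    intro n
    induction n with
    | zero => exact hx₀
    | succ n ih => rw [hξs]; exact hWC _ ih
  let u : ℝ → E := fun t => W (ξ ⌊t⌋₊) (t - ⌊t⌋₊)
  have hu : ∀ n : ℕ, IsVelocity D n x₀ u ∧ x₀ + ∫ s in (0 : ℝ)..n, u s = ξ n := by
    intro n
    induction n with
    | zero => simp [IsVelocity, ξ]
    | succ n ih =>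
      have hc := ih.1.concat (v := W (ξ n)) n.cast_nonneg zero_le_one (by
        rw [ih.2]; exact hW _ (hξC n))
      have heq : EqOn (concat n u (W (ξ n))) u (Ioo 0 ((n : ℝ) + 1)) := by
        intro t ht
        by_cases htn : t < n
        · exact if_pos htn
        · have hfl : ⌊t⌋₊ = n := (Nat.floor_eq_iff ht.1.le).2 ⟨not_lt.1 htn, ht.2⟩
          simp only [concat, if_neg htn, u, hfl]
      have hn : (0 : ℝ) ≤ (n : ℝ) + 1 := by positivity
      rw [Nat.cast_add_one]
      refine ⟨hc.1.congr hn heq, ?_⟩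
      rw [← integral_congr_of_eqOn_Ioo heq hn le_rfl, hc.2 1 ⟨zero_le_one, le_rfl⟩, ← add_assoc,
        ih.2, hξs]
  refine ⟨u, fun T hT => ?_⟩
  obtain ⟨n, hn⟩ := exists_nat_ge T
  exact (hu n).1.mono hT hn

theorem isTimeInterval_Ici : IsTimeInterval (Ici 0) :=
  ⟨ordConnected_Ici, Subset.rfl, self_mem_Ici, 0, self_mem_Ici, 1, mem_Ici.2 zero_le_one, zero_ne_one⟩

/-- Velocities for all times give a solution on `[0, ∞)`. -/
theorem isSolution_of_isVelocity [CompleteSpace E] (hu : ∀ T, 0 ≤ T → IsVelocity D T x₀ u) :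
    IsSolution D (Ici 0) fun t => x₀ + ∫ s in (0 : ℝ)..t, u s := by
  refine ⟨isTimeInterval_Ici, fun a ha b hb => ?_, ?_⟩
  · have hab : (0 : ℝ) ≤ max a b := le_max_of_le_left ha
    refine ((absolutelyContinuousOnInterval_integral (hu _ hab).1).of_dist_le_mul 1
      fun s _ t _ => ?_).mono (uIcc_subset_uIcc ?_ ?_)
    · rw [dist_add_left, one_mul]
    · rw [uIcc_of_le hab]; exact ⟨ha, le_max_left _ _⟩
    · rw [uIcc_of_le hab]; exact ⟨hb, le_max_right _ _⟩
  · rw [← Measure.restrict_congr_set Ioi_ae_eq_Ici, ae_restrict_iff' measurableSet_Ioi]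
    -- Countably many integer horizons cover the half-line with a single null set.
    have hall : ∀ᵐ t : ℝ, ∀ n : ℕ, t ∈ Ioo (0 : ℝ) n →
        -u t ∈ D (x₀ + ∫ s in (0 : ℝ)..t, u s) ∧
          HasDerivAt (fun r => ∫ s in (0 : ℝ)..r, u s) (u t) t := by
      refine ae_all_iff.2 fun n => ?_
      have hn := hu n n.cast_nonneg
      have h1 := hn.2
      rw [ae_restrict_iff' measurableSet_Ioo] at h1
      filter_upwards [h1, hn.1.ae_hasDerivAt_integral] with t h1 h2 ht
      refine ⟨h1 ht, h2 ?_ 0 left_mem_uIcc⟩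
      rw [uIcc_of_le n.cast_nonneg]
      exact Ioo_subset_Icc_self ht
    filter_upwards [hall] with t ht ht0
    obtain ⟨n, hn⟩ := exists_nat_gt t
    obtain ⟨h1, h2⟩ := ht n ⟨ht0, hn⟩
    exact ⟨u t, h1, (h2.const_add x₀).hasDerivWithinAt⟩

end Velocities

end ProxRR

/-! ### Global existence and extension. -/

namespace ProxRR

section Trajectories

variable {E : Type*} [NormedAddCommGroup E] [InnerProductSpace ℝ E] {N : ℕ}
  {f : Fin N → E → ℝ} {D : Fin N → E → Set E} {g : E → EReal}

theorem StandingAssumption.exists_lower_bound (h : StandingAssumption f D g) :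
    ∃ m : ℝ, ∀ y ∈ effDom g, m ≤ ∑ i, f i y + (g y).toReal := by
  obtain ⟨m, hm⟩ := h.bddBelow
  refine ⟨m, fun y hy => ?_⟩
  have := hm y
  rwa [objective, ← EReal.coe_toReal (ne_of_lt hy) (h.g_proper.1 y), ← EReal.coe_add,
    EReal.coe_le_coe_iff] at this

variable [FiniteDimensional ℝ E]

/-- Existence of solutions on the unit interval. -/
theorem StandingAssumption.exists_isVelocity_one (h : StandingAssumption f D g) {x₀ : E}
    (hx₀ : x₀ ∈ effDom g) :
    ∃ u, IsVelocity (fieldSum D g) 1 x₀ u ∧ x₀ + ∫ s in (0 : ℝ)..1, u s ∈ effDom g := by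
  have : CompleteSpace E := FiniteDimensional.complete ℝ E
  have : ProperSpace E := FiniteDimensional.proper ℝ E
  obtain ⟨m, hm⟩ := h.exists_lower_bound
  -- The energy bound on the length over unit time, plus `1` so that the curve stays strictly inside
  -- the ball.
  set R : ℝ := (∑ i, f i x₀ + (g x₀).toReal - m + 1) / 2 + 1 with hR
  have hRpos : 0 ≤ R := by have := hm x₀ hx₀; linarith
  set K : Set E := effDom g ∩ Metric.closedBall x₀ R with hKdef
  have hK : IsCompact K := (isCompact_closedBall x₀ R).inter_left h.g_closed_dom
  have hKsub : K ⊆ effDom g := inter_subset_left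
  have hconv := convexOn_toReal h.g_convex h.g_proper.1
  have hconvK : ConvexOn ℝ K fun y => (g y).toReal :=
    hconv.subset hKsub (hconv.1.inter (convex_closedBall x₀ R))
  obtain ⟨L, hL⟩ := (h.g_locLipschitz.2.mono hKsub).exists_lipschitzOnWith_of_compact hK
  choose M hM using fun i => (h.D_locBounded i).exists_norm_le hK
  have hM0 : ∀ i, 0 ≤ M i := fun i => by
    obtain ⟨v, hv⟩ := h.D_nonempty i x₀
    exact (norm_nonneg v).trans (hM i x₀ ⟨hx₀, Metric.mem_closedBall_self hRpos⟩ v hv)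
  set S : NNReal := L + ∑ i, (M i).toNNReal with hS
  have hScoe : (S : ℝ) = L + ∑ i, M i := by
    rw [hS]; push_cast
    simp only [Real.coe_toNNReal _ (hM0 _)]
  have hclosedD : ∀ i y, IsClosed (D i y) := fun i y =>
    (h.D_conservative i).closed_graph.preimage (by fun_prop : Continuous fun v : E => (y, v))
  obtain ⟨x, hx0, hxlip, hxK, hxG⟩ := exists_lipschitz_solution_of_steps hK (S := S)
    (P := fun y z u => ∃ v ∈ ∑ i, D i y,
      ∃ w ∈ restrictedSubgradients (fun y => (g y).toReal) K z, u = -(v + w))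
    (G := fun y => -(∑ i, D i y + restrictedSubgradients (fun y => (g y).toReal) K y))
    (by
      intro η hη y hy
      choose v hv using fun i => h.D_nonempty i y
      obtain ⟨w, hwK, hw, hwn⟩ := exists_proximal_step hK hconvK hL hy (∑ i, v i) hη
      refine ⟨-(∑ i, v i + w), ?_, hwK, _, (Set.mem_fintype_sum _ _).2 ⟨v, hv, rfl⟩, w, hw, rfl⟩
      rw [norm_neg, hScoe]
      refine hwn.trans (add_le_add_right ?_ _)
      exact (norm_sum_le _ _).trans (Finset.sum_le_sum fun i _ => hM i y hy _ (hv i)))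
    (by
      intro y hy
      -- A compact set plus a closed set is closed; compactness comes from the bounds `M i`.
      refine IsClosed.neg ((isClosed_restrictedSubgradients _ K y).add_left_of_isCompact ?_)
      have hset : ∑ i, D i y = (fun v : Fin N → E => ∑ i, v i) '' univ.pi fun i => D i y := by
        ext v
        simp [Set.mem_fintype_sum]
      rw [hset]
      refine (isCompact_univ_pi fun i => ?_).image (by fun_prop)
      exact (isCompact_closedBall (0 : E) (M i)).of_isClosed_subset (hclosedD i y)
        fun v hv => mem_closedBall_zero_iff.2 (hM i y hy v hv))
    (fun y _ => ((convex_sum _ fun i _ => h.D_convex i y).add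
      (convex_restrictedSubgradients _ K y)).neg)
    (fun y hy ε hε => exists_forall_mem_cthickening
      (fun i => (h.D_conservative i).closed_graph) hM hL.continuousOn S hy hε)
    (x₀ := x₀) ⟨hx₀, Metric.mem_closedBall_self hRpos⟩
  have hdiff : ∀ᵐ t ∂(volume.restrict (Ioo (0 : ℝ) 1)), DifferentiableAt ℝ x t := by
    rw [ae_restrict_iff' measurableSet_Ioo]
    filter_upwards [hxlip.ae_differentiableWithinAt_of_mem_real] with t ht hmem
    exact (ht hmem.1.le).differentiableAt (Ici_mem_nhds hmem.1)
  have hG : ∀ᵐ t ∂(volume.restrict (Ioo (0 : ℝ) 1)), ∃ v ∈ ∑ i, D i (x t),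
      ∃ w ∈ restrictedSubgradients (fun y => (g y).toReal) K (x t),
        HasDerivAt x (-(v + w)) t := by
    filter_upwards [hdiff, ae_restrict_mem measurableSet_Ioo] with t ht hmem
    obtain ⟨v, hv, w, hw, hvw⟩ := Set.mem_add.1 (Set.mem_neg.1 (hxG t hmem.1 _ ht.hasDerivAt))
    refine ⟨v, hv, w, hw, ?_⟩
    rw [hvw, neg_neg]
    exact ht.hasDerivAt
  have hac : AbsolutelyContinuousOnInterval x 0 1 :=
    (hxlip.mono (by
      rw [uIcc_of_le zero_le_one]
      exact Icc_subset_Ici_self)).absolutelyContinuousOnInterval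
  -- The estimate uses the subgradient inequality only along the curve, which lies in `K`, so
  -- truncated subgradients suffice.
  obtain ⟨hint, hrep, hbound⟩ := h.energy_estimate hm one_pos hac
    (fun t ht => hKsub (hxK t ht.1)) (hG.mono fun t ⟨v, hv, w, hw, hd⟩ =>
      ⟨v, hv, w, fun s hs => hw _ (hxK s hs.1), hd⟩)
  rw [hx0] at hrep hbound
  have hball : ∀ t ∈ Icc (0 : ℝ) 1, dist (x t) x₀ < R := by
    intro t ht
    rw [dist_eq_norm, hrep t ht, add_sub_cancel_left]
    have h1 := intervalIntegral.norm_integral_le_integral_norm (f := deriv x) (μ := volume) ht.1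
    have h2 : ∫ s in (0 : ℝ)..t, ‖deriv x s‖ ≤ ∫ s in (0 : ℝ)..1, ‖deriv x s‖ :=
      intervalIntegral.integral_mono_interval le_rfl ht.1 ht.2
        (Eventually.of_forall fun s => norm_nonneg _) hint.norm
    linarith
  refine ⟨deriv x, ⟨hint, ?_⟩, ?_⟩
  · filter_upwards [hG, ae_restrict_mem measurableSet_Ioo] with t ht hmem
    obtain ⟨v, hv, w, hw, hd⟩ := ht
    have htI := Ioo_subset_Icc_self hmem
    rw [← hrep t htI, hd.deriv, neg_neg]
    have hxt := hKsub (hxK t hmem.1.le)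
    refine Set.add_mem_add hv (mem_clarkeSubdiff h.g_proper.1 (ne_of_lt hxt) fun y hy => ?_)
    exact restrictedSubgradients_of_ball hconv hxt (hball t htI) hw y (lt_top_iff_ne_top.2 hy)
  · rw [← hrep 1 ⟨zero_le_one, le_rfl⟩]
    exact hKsub (hxK 1 zero_le_one)

/-- Existence of velocities for all times from every point of the domain. -/
theorem StandingAssumption.exists_isVelocity (h : StandingAssumption f D g) {x₀ : E}
    (hx₀ : x₀ ∈ effDom g) : ∃ u, ∀ T, 0 ≤ T → IsVelocity (fieldSum D g) T x₀ u :=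
  exists_isVelocity_of_unit (fun _ hξ => h.exists_isVelocity_one hξ) hx₀

/-- A time interval other than `[0, ∞)` is bounded. -/
theorem IsTimeInterval.exists_Ioo_subset {I : Set ℝ} (hI : IsTimeInterval I) (hne : I ≠ Ici 0) :
    ∃ T, 0 < T ∧ Ioo 0 T ⊆ I ∧ I ⊆ Icc 0 T := by
  obtain ⟨hord, hsub, h0, hnt⟩ := hI
  have hbdd : BddAbove I := by
    by_contra hunb
    refine hne (hsub.antisymm fun t ht => ?_)
    obtain ⟨s, hs, hts⟩ := not_bddAbove_iff.1 hunb t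
    exact hord.out h0 hs ⟨ht, hts.le⟩
  have hpos : 0 < sSup I := by
    obtain ⟨t, ht, hne⟩ := hnt.exists_ne 0
    exact (lt_of_le_of_ne (hsub ht) hne.symm).trans_le (le_csSup hbdd ht)
  refine ⟨sSup I, hpos, fun t ht => ?_, fun t ht => ⟨hsub ht, le_csSup hbdd ht⟩⟩
  obtain ⟨s, hs, hts⟩ := exists_lt_of_lt_csSup ⟨0, h0⟩ ht.2
  exact hord.out h0 hs ⟨ht.1.le, hts.le⟩

/-- A solution on a bounded interval is given by an integrable velocity up to the end time. -/
theorem StandingAssumption.exists_isVelocity_of_isSolution (h : StandingAssumption f D g)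
    {I : Set ℝ} {x : ℝ → E} (hx : IsSolution (fieldSum D g) I x) {T : ℝ} (hT : 0 < T)
    (hTI : Ioo 0 T ⊆ I) (hIT : I ⊆ Icc 0 T) :
    ∃ u, IsVelocity (fieldSum D g) T (x 0) u ∧
      (∀ t ∈ I, x t = x 0 + ∫ s in (0 : ℝ)..t, u s) ∧
      x 0 + ∫ s in (0 : ℝ)..T, u s ∈ effDom g := by
  obtain ⟨m, hm⟩ := h.exists_lower_bound
  obtain ⟨⟨hord, -, h0, -⟩, hac, hsol⟩ := hx
  have hsol' : ∀ b ∈ I, 0 < b → ∀ᵐ t ∂(volume.restrict (Ioo (0 : ℝ) b)),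
      ∃ x' ∈ -fieldSum D g (x t), HasDerivAt x x' t := by
    intro b hb _
    have hsub : Ioo 0 b ⊆ I := fun t ht => hord.out h0 hb (Ioo_subset_Icc_self ht)
    filter_upwards [ae_restrict_of_ae_restrict_of_subset hsub hsol,
      ae_restrict_mem measurableSet_Ioo] with t ⟨x', hx', hd⟩ hmem
    exact ⟨x', hx', hd.hasDerivAt (mem_of_superset (Ioo_mem_nhds hmem.1 hmem.2) hsub)⟩
  -- Almost every `x t` has a subgradient of `g`, hence lies in `dom g`; closedness gives every
  -- time.
  have hdom : ∀ b ∈ I, 0 < b → ∀ t ∈ Icc 0 b, x t ∈ effDom g := by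
    intro b hb hb0
    have hcont := (hac 0 h0 b hb).continuousOn
    rw [uIcc_of_le hb0.le] at hcont
    refine h.g_closed_dom.forall_mem_of_ae_mem hb0 hcont ?_
    filter_upwards [hsol' b hb hb0] with t ⟨x', hx', _⟩
    obtain ⟨v, _, w, hw, _⟩ := Set.mem_add.1 (Set.mem_neg.1 hx')
    exact lt_top_iff_ne_top.2 hw.2.1
  have henergy := fun b (hb : b ∈ I) (hb0 : 0 < b) => h.energy_estimate hm hb0 (hac 0 h0 b hb)
    (hdom b hb hb0) (by
      filter_upwards [hsol' b hb hb0] with t ⟨x', hx', hd⟩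
      obtain ⟨v, hv, w, hw, hvw⟩ := Set.mem_add.1 (Set.mem_neg.1 hx')
      refine ⟨v, hv, w, fun s hs => inner_le_of_mem_clarkeSubdiff h.g_convex hw
        (ne_of_lt (hdom b hb hb0 s hs)), ?_⟩
      rw [hvw, neg_neg]
      exact hd)
  have hrep : ∀ t ∈ I, x t = x 0 + ∫ s in (0 : ℝ)..t, deriv x s := by
    intro t ht
    rcases (hIT ht).1.eq_or_lt with rfl | ht0
    · simp
    · exact (henergy t ht ht0).2.1 t ⟨ht0.le, le_rfl⟩
  have hseq : Tendsto (fun n : ℕ => T * ((n : ℝ) / ((n : ℝ) + 1))) atTop (𝓝 T) := by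
    simpa using (tendsto_natCast_div_add_atTop (1 : ℝ)).const_mul T
  have hseqmem : ∀ n : ℕ, T * ((n : ℝ) / ((n : ℝ) + 1)) < T := fun n => by
    refine mul_lt_of_lt_one_right hT ?_
    rw [div_lt_one (by positivity)]
    exact lt_add_one _
  -- The length bound is uniform in `b < T`, which gives integrability up to `T` even if `T ∉ I`.
  have hint : IntervalIntegrable (deriv x) volume 0 T := by
    rw [intervalIntegrable_iff_integrableOn_Ioc_of_le hT.le]
    have hbd : ∀ b, 0 ≤ b → b < T → IntegrableOn (deriv x) (Ioc 0 b) ∧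
        ∫ s in Ioc (0 : ℝ) b, ‖deriv x s‖ ≤
          (∑ i, f i (x 0) + (g (x 0)).toReal - m + T) / 2 := by
      intro b hb0 hbT
      have hb' : ∀ c, 0 < c → c < T → IntegrableOn (deriv x) (Ioc 0 c) ∧
          ∫ s in Ioc (0 : ℝ) c, ‖deriv x s‖ ≤
            (∑ i, f i (x 0) + (g (x 0)).toReal - m + T) / 2 := by
        intro c hc0 hcT
        obtain ⟨h1, -, h2⟩ := henergy c (hTI ⟨hc0, hcT⟩) hc0
        rw [intervalIntegral.integral_of_le hc0.le] at h2
        exact ⟨(intervalIntegrable_iff_integrableOn_Ioc_of_le hc0.le).1 h1, by linarith⟩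
      -- The approximating sequence starts at `0`, where the energy estimate does not apply.
      rcases hb0.eq_or_lt with rfl | hb0
      · have := (hb' (T / 2) (by linarith) (by linarith)).2
        have h0 : 0 ≤ ∫ s in Ioc (0 : ℝ) (T / 2), ‖deriv x s‖ :=
          integral_nonneg fun _ => norm_nonneg _
        simpa using h0.trans this
      · exact hb' b hb0 hbT
    have hnn : ∀ n : ℕ, 0 ≤ T * ((n : ℝ) / ((n : ℝ) + 1)) := fun n => by positivity
    exact integrableOn_Ioc_of_intervalIntegral_norm_bounded_right
      (fun n => (hbd _ (hnn n) (hseqmem n)).1) hseq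
      (Eventually.of_forall fun n => (hbd _ (hnn n) (hseqmem n)).2)
  refine ⟨deriv x, ⟨hint, ?_⟩, hrep, ?_⟩
  · filter_upwards [ae_restrict_of_ae_restrict_of_subset hTI hsol,
      ae_restrict_mem measurableSet_Ioo] with t ⟨x', hx', hd⟩ hmem
    rw [← hrep t (hTI hmem), (hd.hasDerivAt
      (mem_of_superset (Ioo_mem_nhds hmem.1 hmem.2) hTI)).deriv]
    exact hx'
  · have hcont := (absolutelyContinuousOnInterval_integral hint).continuousOn
    rw [uIcc_of_le hT.le] at hcont
    have hcl := h.g_closed_dom.forall_mem_of_ae_mem hT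
      (x := fun t => x 0 + ∫ s in (0 : ℝ)..t, deriv x s) (continuousOn_const.add hcont) (by
        filter_upwards [ae_restrict_mem measurableSet_Ioo] with t ht
        rw [← hrep t (hTI ht)]
        exact hdom t (hTI ht) ht.1 t ⟨ht.1.le, le_rfl⟩)
    exact hcl T ⟨hT.le, le_rfl⟩

end Trajectories

end ProxRR

theorem mainTheorem9 {E : Type*} [NormedAddCommGroup E] [InnerProductSpace ℝ E]
    [FiniteDimensional ℝ E] {N : ℕ} (f : Fin N → E → ℝ) (D : Fin N → E → Set E) (g : E → EReal)
    (h : ProxRR.StandingAssumption f D g) :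
    (∀ (I : Set ℝ) (x : ℝ → E),
      ProxRR.IsTrajectory (ProxRR.fieldSum D g) I x → I = Set.Ici (0 : ℝ)) ∧
    (∀ x₀ ∈ ProxRR.effDom (ProxRR.objective f g), ∃ x : ℝ → E,
      ProxRR.IsTrajectory (ProxRR.fieldSum D g) (Set.Ici (0 : ℝ)) x ∧ x 0 = x₀) := by
  have : CompleteSpace E := FiniteDimensional.complete ℝ E
  refine ⟨fun I x hx => ?_, fun x₀ hx₀ => ?_⟩
  · by_contra hne
    obtain ⟨T, hT, hTI, hIT⟩ := hx.1.1.exists_Ioo_subset hne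
    obtain ⟨u, hu, hxu, hend⟩ := h.exists_isVelocity_of_isSolution hx.1 hT hTI hIT
    obtain ⟨v, hv⟩ := h.exists_isVelocity hend
    -- Continuing from the limit at `T` gives a solution on `[0, ∞)` that extends `x`, against
    -- maximality.
    have hsol := ProxRR.isSolution_of_isVelocity (D := ProxRR.fieldSum D g) (x₀ := x 0)
      (u := ProxRR.concat T u v) fun b hb =>
        (hu.concat hT.le hb (hv b hb)).1.mono hb (le_add_of_nonneg_left hT.le)
    refine hne (hx.2 _ _ hsol hx.1.1.2.1 fun t ht => ?_).symm
    rw [hxu t ht, ProxRR.integral_congr_of_eqOn_Ioo ProxRR.concat_eqOn (hIT ht).1 (hIT ht).2]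
  · have hx₀g : x₀ ∈ ProxRR.effDom g := by
      change g x₀ < ⊤
      refine lt_top_iff_ne_top.2 fun htop => ?_
      have hlt : ((∑ i, f i x₀ : ℝ) : EReal) + g x₀ < ⊤ := hx₀
      rw [htop, EReal.coe_add_top] at hlt
      exact lt_irrefl _ hlt
    obtain ⟨u, hu⟩ := h.exists_isVelocity hx₀g
    refine ⟨_, ⟨ProxRR.isSolution_of_isVelocity hu, fun J y hy hJ _ => ?_⟩, by simp⟩
    -- Time intervals lie in `[0, ∞)`, so a solution on all of it is maximal.
    exact hy.1.2.1.antisymm hJ
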